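/- **Setting.** Let $d\ge 1$ and let $A_1,\dots,A_{d^2}$ and $B_1,\dots,B_{d^2}$ be complete families of local orthogonal observables on the two copies of $\mathbb C^d$, i.e. Hermitian $d\times d$ matrices with $\operatorname{tr}(A_iA_j)=\delta_{ij}=\operatorname{tr}(B_iB_j)$. For a state $\varrho$ and observables $\{M_\alpha\}$ the covariance matrix is $$\gamma(\varrho,\{M_\alpha\})_{\alpha\beta}=\tfrac12\langle M_\alpha M_\beta+M_\beta M_\alpha\rangle_\varrho-\langle M_\alpha\rangle_\varrho\langle M_\beta\rangle_\varrho,\qquad \langle M\rangle_\varrho=\operatorname{tr}(\varrho M).$$ For a state $\varrho$ on $\mathbb C^d\otimes\mathbb C^d$ let $\gamma(\varrho)$ be its covariance matrix for the observables $\{A_i\otimes\mathbb 1,\ \mathbb 1\otimes B_j\}$, and put $$V(\varrho)=\max_{t,\kappa_A,\kappa_B}\{\,t\le 1:\ \gamma(\varrho)-t\,(\kappa_A\oplus\kappa_B)\ge 0\,\},\qquad \mathcal E(\varrho)=1-V(\varrho),$$ where $\ge 0$ means positive semidefinite and $(\kappa_A,\kappa_B)$ ranges over all pairs $\kappa_A=\sum_k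 p_k\,\gamma(|\psi_k\rangle\langle\psi_k|,\{A_i\})$, $\kappa_B=\sum_k p_k\,\gamma(|\phi_k\rangle\langle\phi_k|,\{B_j\})$ with finitely many unit vectors $\psi_k,\phi_k\in\mathbb C^d$ and common convex weights $p_k$. Let $|\psi\rangle=\sum_{i=1}^d\sqrt{\lambda_i}\,|a_i\rangle\otimes|b_i\rangle$ with orthonormal bases $(a_i)$, $(b_i)$ of $\mathbb C^d$, $\lambda_i\ge 0$ and $\sum_i\lambda_i=1$, and write $\mathcal E(|\psi\rangle)=\mathcal E(|\psi\rangle\langle\psi|)$. **Proposition.** For $d=3$ and for $d=4$, and for any choice of the local orthogonal observables, the maximum that defines $V(|\psi\rangle\langle\psi|)$ is attained, and: (a) If $d=3$, then $$\mathcal E(|\psi\rangle)=2\sqrt{\lambda_{i_0}\lambda_{j_0}}+2\sqrt{\lambda_{i_0}\lambda_{k_0}}-\lambda_{i_0}$$ whenever $i_0,j_0,k_0$ are pairwise different and $(\sqrt{\lambda_{j_0}}-\sqrt{\lambda_{k_0}})^2\ge(\sqrt{\lambda_j}-\sqrt{\lambda_k})^2$ for all $j,k$. (b) If $d=4$, then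 $$\mathcal E(|\psi\rangle)=\max\{\,2\sqrt{\lambda_1\lambda_2}+2\sqrt{\lambda_3\lambda_4},\ 2\sqrt{\lambda_1\lambda_3}+2\sqrt{\lambda_2\lambda_4},\ 2\sqrt{\lambda_1\lambda_4}+2\sqrt{\lambda_2\lambda_3}\,\}.$$ -/

import Mathlib

open scoped Kronecker

noncomputable section

namespace CMCEntanglement

/-- A family of `d²` local orthogonal observables on `ℂ^d`: Hermitian matrices with
`tr (A i * A j) = δ_ij`. -/
structure IsLocalOrthogonalObservables {d : ℕ}
    (A : Fin (d ^ 2) → Matrix (Fin d) (Fin d) ℂ) : Prop where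
  isHermitian : ∀ i, (A i).IsHermitian
  trace_mul : ∀ i j, (A i * A j).trace = if i = j then 1 else 0

/-- The expectation value `⟨M⟩_ρ = tr (ρ M)`. It is real whenever `ρ` and `M` are Hermitian, and
only such arguments are of interest. -/
def expectation {m : Type*} [Fintype m] (ρ M : Matrix m m ℂ) : ℝ :=
  ((ρ * M).trace).re

/-- The covariance matrix
`γ(ρ, {M})_{αβ} = ½ ⟨M_α M_β + M_β M_α⟩_ρ - ⟨M_α⟩_ρ ⟨M_β⟩_ρ`. -/
def covarianceMatrix {m ι : Type*} [Fintype m] (ρ : Matrix m m ℂ) (M : ι → Matrix m m ℂ) :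
    Matrix ι ι ℝ :=
  Matrix.of fun α β =>
    (1 / 2) * expectation ρ (M α * M β + M β * M α) - expectation ρ (M α) * expectation ρ (M β)

/-- The joint family `{A_i ⊗ 1, 1 ⊗ B_j}` of observables on `ℂ^dA ⊗ ℂ^dB`. -/
def jointObservables {dA dB : ℕ}
    (A : Fin (dA ^ 2) → Matrix (Fin dA) (Fin dA) ℂ)
    (B : Fin (dB ^ 2) → Matrix (Fin dB) (Fin dB) ℂ) :
    Fin (dA ^ 2) ⊕ Fin (dB ^ 2) → Matrix (Fin dA × Fin dB) (Fin dA × Fin dB) ℂ :=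
  Sum.elim (fun i => A i ⊗ₖ (1 : Matrix (Fin dB) (Fin dB) ℂ))
    (fun j => (1 : Matrix (Fin dA) (Fin dA) ℂ) ⊗ₖ B j)

/-- The rank-one matrix `|ψ⟩⟨ψ|`. -/
def pureState {m : Type*} (ψ : EuclideanSpace ℂ m) : Matrix m m ℂ :=
  Matrix.of fun i j => ψ i * star (ψ j)

/-- The pairs `(κ_A, κ_B)` with `κ_A = ∑ k, p_k γ(|ψ_k⟩⟨ψ_k|, {A_i})` and
`κ_B = ∑ k, p_k γ(|φ_k⟩⟨φ_k|, {B_j})` for finitely many unit vectors `ψ_k ∈ ℂ^dA`,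
`φ_k ∈ ℂ^dB` and convex weights `p_k` common to both sides. -/
def IsKappaPair {dA dB : ℕ}
    (A : Fin (dA ^ 2) → Matrix (Fin dA) (Fin dA) ℂ)
    (B : Fin (dB ^ 2) → Matrix (Fin dB) (Fin dB) ℂ)
    (κA : Matrix (Fin (dA ^ 2)) (Fin (dA ^ 2)) ℝ)
    (κB : Matrix (Fin (dB ^ 2)) (Fin (dB ^ 2)) ℝ) : Prop :=
  ∃ (K : ℕ) (p : Fin K → ℝ) (ψ : Fin K → EuclideanSpace ℂ (Fin dA))
    (φ : Fin K → EuclideanSpace ℂ (Fin dB)),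
    (∀ k, 0 ≤ p k) ∧ ∑ k, p k = 1 ∧ (∀ k, ‖ψ k‖ = 1) ∧ (∀ k, ‖φ k‖ = 1) ∧
    κA = ∑ k, p k • covarianceMatrix (pureState (ψ k)) A ∧
    κB = ∑ k, p k • covarianceMatrix (pureState (φ k)) B

/-- The set of all `t ≤ 1` such that `γ(ρ) - t (κ_A ⊕ κ_B) ≥ 0` for some `κ_A, κ_B`. -/
def admissibleParameters {dA dB : ℕ}
    (A : Fin (dA ^ 2) → Matrix (Fin dA) (Fin dA) ℂ)
    (B : Fin (dB ^ 2) → Matrix (Fin dB) (Fin dB) ℂ)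
    (ρ : Matrix (Fin dA × Fin dB) (Fin dA × Fin dB) ℂ) : Set ℝ :=
  {t | t ≤ 1 ∧ ∃ κA κB, IsKappaPair A B κA κB ∧
    (covarianceMatrix ρ (jointObservables A B) -
      t • Matrix.fromBlocks κA 0 0 κB).PosSemidef}

/-- `V(ρ) = max {t ≤ 1 : γ(ρ) - t (κ_A ⊕ κ_B) ≥ 0}`, the maximum being over `t, κ_A, κ_B`. -/
def V {dA dB : ℕ}
    (A : Fin (dA ^ 2) → Matrix (Fin dA) (Fin dA) ℂ)
    (B : Fin (dB ^ 2) → Matrix (Fin dB) (Fin dB) ℂ)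
    (ρ : Matrix (Fin dA × Fin dB) (Fin dA × Fin dB) ℂ) : ℝ :=
  sSup (admissibleParameters A B ρ)

/-- The entanglement parameter `𝓔(ρ) = 1 - V(ρ)`. -/
def entanglementParameter {dA dB : ℕ}
    (A : Fin (dA ^ 2) → Matrix (Fin dA) (Fin dA) ℂ)
    (B : Fin (dB ^ 2) → Matrix (Fin dB) (Fin dB) ℂ)
    (ρ : Matrix (Fin dA × Fin dB) (Fin dA × Fin dB) ℂ) : ℝ :=
  1 - V A B ρ

/-- The vector `∑ k, √(lam k) |a_k⟩ ⊗ |b_k⟩` of `ℂ^d ⊗ ℂ^d`, in coordinates. -/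
def schmidtVector {d : ℕ} (a b : OrthonormalBasis (Fin d) ℂ (EuclideanSpace ℂ (Fin d)))
    (lam : Fin d → ℝ) : EuclideanSpace ℂ (Fin d × Fin d) :=
  WithLp.toLp 2 fun x => ∑ k, (√(lam k) : ℂ) * a k x.1 * b k x.2

end CMCEntanglement

end

/-! Write `s i = √(lam i)`. The value `V` of a Schmidt vector is the optimum of a linear program:
maximise `∑ w i` over `w ≥ 0` with `w i + w j ≤ (s i - s j) ^ 2` for `i ≠ j`.

Local orthogonal observables span the Hermitian matrices, so `γ(ρ) - t (κ_A ⊕ κ_B) ≥ 0` is an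
inequality between variances of `X ⊗ 1 + 1 ⊗ Y` and of `X`, `Y` (`mem_admissibleParameters_iff`). In
the Schmidt bases the choice `Y = -Xᵀ` has variance `∑ (s i - s j) ^ 2 |X i j| ^ 2`. Diagonal matrix
units make this vanish, so for `t > 0` every `ψ_k`, `φ_k` of positive weight is a Schmidt basis
vector up to phase; the matrices `E_ij + E_ji` then give the pairwise constraints
(`exists_weights_of_mem_admissibleParameters`). Conversely, feasible weights placed on the Schmidt
bases satisfy the inequality for all `X`, `Y` (`mem_admissibleParameters_of_weights`).

For `d = 3`, adding the two constraints at the middle coefficient bounds the sum, and weight zero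
there attains the bound. For `d = 4`, each perfect matching of the indices gives a bound, and the
matching of neighbours in sorted order is attained. -/

namespace CMCEntanglement

open Matrix

/-- The variance `⟨H²⟩_ρ - ⟨H⟩_ρ²`. -/
noncomputable def variance {m : Type*} [Fintype m] (ρ H : Matrix m m ℂ) : ℝ :=
  expectation ρ (H * H) - expectation ρ H ^ 2

/-! ### Covariance matrices as quadratic forms; unitary invariance of the variance -/

section General

variable {m ι : Type*} [Fintype m]

theorem covarianceMatrix_isHermitian (ρ : Matrix m m ℂ) (M : ι → Matrix m m ℂ) :
    (covarianceMatrix ρ M).IsHermitian := by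
  ext i j
  simp [covarianceMatrix, add_comm, mul_comm]

variable [Fintype ι]

theorem expectation_add (ρ M N : Matrix m m ℂ) :
    expectation ρ (M + N) = expectation ρ M + expectation ρ N := by
  simp [expectation, Matrix.mul_add]

theorem expectation_smul (ρ M : Matrix m m ℂ) (c : ℝ) :
    expectation ρ (c • M) = c * expectation ρ M := by
  simp [expectation]

theorem expectation_sum (ρ : Matrix m m ℂ) (M : ι → Matrix m m ℂ) :
    expectation ρ (∑ i, M i) = ∑ i, expectation ρ (M i) := by
  simp [expectation, Matrix.mul_sum, Matrix.trace_sum]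

/-- The quadratic form of the covariance matrix is the variance of the linear combination. -/
theorem dotProduct_covarianceMatrix_mulVec (ρ : Matrix m m ℂ) (M : ι → Matrix m m ℂ)
    (x : ι → ℝ) :
    x ⬝ᵥ (covarianceMatrix ρ M *ᵥ x) = variance ρ (∑ i, x i • M i) := by
  have h1 : expectation ρ ((∑ i, x i • M i) * ∑ i, x i • M i) =
      ∑ i, ∑ j, x i * x j * expectation ρ (M i * M j) := by
    rw [Finset.sum_mul, expectation_sum]
    refine Finset.sum_congr rfl fun i _ => ?_
    rw [Finset.mul_sum, expectation_sum]
    refine Finset.sum_congr rfl fun j _ => ?_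
    rw [smul_mul_smul_comm, expectation_smul]
  have h2 : ∑ i, ∑ j, x i * x j * expectation ρ (M j * M i) =
      ∑ i, ∑ j, x i * x j * expectation ρ (M i * M j) := by
    rw [Finset.sum_comm]
    simp only [mul_comm (x _) (x _)]
  have h3 : expectation ρ (∑ i, x i • M i) ^ 2 =
      ∑ i, ∑ j, x i * x j * (expectation ρ (M i) * expectation ρ (M j)) := by
    simp only [expectation_sum, expectation_smul, sq, Finset.sum_mul_sum]
    exact Finset.sum_congr rfl fun i _ => Finset.sum_congr rfl fun j _ => by ring
  have h4 : x ⬝ᵥ (covarianceMatrix ρ M *ᵥ x) =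
      ∑ i, ∑ j, ((1 / 2) * (x i * x j * expectation ρ (M i * M j)) +
        (1 / 2) * (x i * x j * expectation ρ (M j * M i)) -
          x i * x j * (expectation ρ (M i) * expectation ρ (M j))) := by
    simp only [dotProduct, mulVec, covarianceMatrix, of_apply, Finset.mul_sum, expectation_add]
    exact Finset.sum_congr rfl fun i _ => Finset.sum_congr rfl fun j _ => by ring
  rw [h4, variance, h1, h3]
  simp only [Finset.sum_add_distrib, Finset.sum_sub_distrib, ← Finset.mul_sum]
  rw [h2]
  ring

theorem pureState_mulVec (U : Matrix m m ℂ) (ψ : EuclideanSpace ℂ m) :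
    pureState (WithLp.toLp 2 (U *ᵥ ψ.ofLp)) = U * pureState ψ * Uᴴ := by
  have h (φ : EuclideanSpace ℂ m) : pureState φ = vecMulVec φ.ofLp (star φ.ofLp) := rfl
  rw [h, h, mul_vecMulVec, vecMulVec_mul, star_mulVec]

variable [DecidableEq m]

theorem expectation_conj {U : Matrix m m ℂ} (hU : Uᴴ * U = 1) (ρ H : Matrix m m ℂ) :
    expectation (U * ρ * Uᴴ) (U * H * Uᴴ) = expectation ρ H := by
  have : U * ρ * Uᴴ * (U * H * Uᴴ) = U * (ρ * (Uᴴ * U) * H * Uᴴ) := by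
    simp only [Matrix.mul_assoc]
  rw [expectation, this, hU, Matrix.trace_mul_comm]
  simp only [Matrix.mul_assoc, hU, Matrix.mul_one, expectation]

theorem variance_conj {U : Matrix m m ℂ} (hU : Uᴴ * U = 1) (ρ H : Matrix m m ℂ) :
    variance (U * ρ * Uᴴ) (U * H * Uᴴ) = variance ρ H := by
  have : U * H * Uᴴ * (U * H * Uᴴ) = U * (H * H) * Uᴴ := by
    calc U * H * Uᴴ * (U * H * Uᴴ) = U * (H * (Uᴴ * U) * H) * Uᴴ := by
          simp only [Matrix.mul_assoc]
      _ = _ := by rw [hU, Matrix.mul_one]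
  rw [variance, this, expectation_conj hU, expectation_conj hU, variance]

end General

/-! ### Independence of the choice of local orthogonal observables -/

section Observables

variable {d : ℕ}

/-- Local orthogonal observables span the Hermitian matrices over `ℝ`. -/
theorem IsLocalOrthogonalObservables.exists_eq_sum_smul
    {A : Fin (d ^ 2) → Matrix (Fin d) (Fin d) ℂ} (hA : IsLocalOrthogonalObservables A)
    {H : Matrix (Fin d) (Fin d) ℂ} (hH : H.IsHermitian) :
    ∃ x : Fin (d ^ 2) → ℝ, ∑ i, x i • A i = H := by
  -- Pairing with `A j` reads off the `j`-th coefficient. This gives independence, hence spanning by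
  -- dimension, and also reality of the coefficients of a Hermitian matrix.
  have htr (c : Fin (d ^ 2) → ℂ) (j : Fin (d ^ 2)) : ((∑ i, c i • A i) * A j).trace = c j := by
    simp [Finset.sum_mul, Matrix.trace_sum, hA.trace_mul]
  have hli : LinearIndependent ℂ A := by
    rw [Fintype.linearIndependent_iff]
    intro c hc j
    rw [← htr c j, hc]
    simp
  have hspan : Submodule.span ℂ (Set.range A) = ⊤ := by
    apply hli.span_eq_top_of_card_eq_finrank'
    simp [Module.finrank_matrix, sq]
  obtain ⟨c, hc⟩ := (Submodule.mem_span_range_iff_exists_fun ℂ).1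
    (hspan ▸ Submodule.mem_top : H ∈ Submodule.span ℂ (Set.range A))
  refine ⟨fun i => (c i).re, ?_⟩
  rw [← hc]
  refine Finset.sum_congr rfl fun j _ => ?_
  have hreal : star (c j) = c j := by
    rw [← htr c j, hc, ← Matrix.trace_conjTranspose, Matrix.conjTranspose_mul, hH.eq,
      (hA.isHermitian j).eq, Matrix.trace_mul_comm]
  rw [← Complex.conj_eq_iff_re.1 hreal]
  ext
  simp

theorem isHermitian_sum_smul {m ι : Type*} [Fintype ι] {A : ι → Matrix m m ℂ}
    (hA : ∀ i, (A i).IsHermitian) (x : ι → ℝ) : (∑ i, x i • A i).IsHermitian := by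
  rw [IsHermitian, conjTranspose_sum]
  refine Finset.sum_congr rfl fun i _ => ?_
  ext j k
  simp [← (hA i).apply j k]

/-- The defining condition on `t`, expressed by variances of local Hermitian observables; it does
not depend on the choice of the local orthogonal observables. -/
theorem mem_admissibleParameters_iff {A B : Fin (d ^ 2) → Matrix (Fin d) (Fin d) ℂ}
    (hA : IsLocalOrthogonalObservables A) (hB : IsLocalOrthogonalObservables B)
    (ρ : Matrix (Fin d × Fin d) (Fin d × Fin d) ℂ) (t : ℝ) :
    t ∈ admissibleParameters A B ρ ↔ t ≤ 1 ∧
      ∃ (K : ℕ) (p : Fin K → ℝ) (ψ φ : Fin K → EuclideanSpace ℂ (Fin d)),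
        (∀ k, 0 ≤ p k) ∧ ∑ k, p k = 1 ∧ (∀ k, ‖ψ k‖ = 1) ∧ (∀ k, ‖φ k‖ = 1) ∧
        ∀ X Y : Matrix (Fin d) (Fin d) ℂ, X.IsHermitian → Y.IsHermitian →
          t * ∑ k, p k * (variance (pureState (ψ k)) X + variance (pureState (φ k)) Y) ≤
            variance ρ (X ⊗ₖ (1 : Matrix (Fin d) (Fin d) ℂ) +
              (1 : Matrix (Fin d) (Fin d) ℂ) ⊗ₖ Y) := by
  -- The quadratic form at `(x, y)` is the gap in the variance inequality for `X = ∑ x i A i` and `Y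
  -- = ∑ y j B j`.
  have key {K : ℕ} (p : Fin K → ℝ) (ψ φ : Fin K → EuclideanSpace ℂ (Fin d))
      (x y : Fin (d ^ 2) → ℝ) :
      Sum.elim x y ⬝ᵥ ((covarianceMatrix ρ (jointObservables A B) -
        t • fromBlocks (∑ k, p k • covarianceMatrix (pureState (ψ k)) A) 0 0
          (∑ k, p k • covarianceMatrix (pureState (φ k)) B)) *ᵥ Sum.elim x y) =
      variance ρ ((∑ i, x i • A i) ⊗ₖ (1 : Matrix (Fin d) (Fin d) ℂ) +
        (1 : Matrix (Fin d) (Fin d) ℂ) ⊗ₖ (∑ j, y j • B j)) -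
      t * ∑ k, p k * (variance (pureState (ψ k)) (∑ i, x i • A i) +
        variance (pureState (φ k)) (∑ j, y j • B j)) := by
    have hjoint : ∑ i, Sum.elim x y i • jointObservables A B i =
        (∑ i, x i • A i) ⊗ₖ (1 : Matrix (Fin d) (Fin d) ℂ) +
        (1 : Matrix (Fin d) (Fin d) ℂ) ⊗ₖ (∑ j, y j • B j) := by
      rw [Fintype.sum_sum_type]
      congr 1
      · ext i j
        simp [jointObservables, Matrix.sum_apply, kroneckerMap_apply, Finset.sum_mul, mul_assoc]
      · ext i j
        simp [jointObservables, Matrix.sum_apply, kroneckerMap_apply, Finset.mul_sum,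
          mul_left_comm]
    rw [sub_mulVec, dotProduct_sub, dotProduct_covarianceMatrix_mulVec, hjoint, smul_mulVec,
      dotProduct_smul, fromBlocks_mulVec]
    simp only [Sum.elim_comp_inl, Sum.elim_comp_inr, zero_mulVec, add_zero, zero_add,
      sumElim_dotProduct_sumElim, sum_mulVec, dotProduct_sum, smul_mulVec, dotProduct_smul,
      dotProduct_covarianceMatrix_mulVec, smul_eq_mul, mul_add, Finset.sum_add_distrib]
  refine and_congr_right fun _ => ⟨?_, ?_⟩
  · rintro ⟨κA, κB, ⟨K, p, ψ, φ, hp, hp1, hψ, hφ, rfl, rfl⟩, hpsd⟩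
    refine ⟨K, p, ψ, φ, hp, hp1, hψ, hφ, fun X Y hX hY => ?_⟩
    obtain ⟨x, rfl⟩ := hA.exists_eq_sum_smul hX
    obtain ⟨y, rfl⟩ := hB.exists_eq_sum_smul hY
    have := hpsd.dotProduct_mulVec_nonneg (Sum.elim x y)
    rw [star_trivial, key] at this
    linarith
  · rintro ⟨K, p, ψ, φ, hp, hp1, hψ, hφ, h⟩
    refine ⟨_, _, ⟨K, p, ψ, φ, hp, hp1, hψ, hφ, rfl, rfl⟩,
      PosSemidef.of_dotProduct_mulVec_nonneg ?_ fun z => ?_⟩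
    · have hsum {K : ℕ} (p : Fin K → ℝ) (ψ : Fin K → EuclideanSpace ℂ (Fin d))
          (A : Fin (d ^ 2) → Matrix (Fin d) (Fin d) ℂ) :
          (∑ k, p k • covarianceMatrix (pureState (ψ k)) A).IsHermitian := by
        rw [IsHermitian, conjTranspose_sum]
        refine Finset.sum_congr rfl fun k _ => ?_
        rw [conjTranspose_smul, star_trivial, (covarianceMatrix_isHermitian _ _).eq]
      refine (covarianceMatrix_isHermitian _ _).sub ?_
      rw [IsHermitian, conjTranspose_smul, star_trivial, fromBlocks_conjTranspose,
        (hsum p ψ A).eq, (hsum p φ B).eq, conjTranspose_zero]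
    · have := h _ _ (isHermitian_sum_smul hA.isHermitian (z ∘ Sum.inl))
        (isHermitian_sum_smul hB.isHermitian (z ∘ Sum.inr))
      rw [star_trivial, ← Sum.elim_comp_inl_inr z, key]
      linarith

end Observables

/-! ### Passage to the Schmidt bases -/

section Unitary

variable {d : ℕ}

/-- The unitary matrix whose columns are the vectors of an orthonormal basis. -/
noncomputable def columnMatrix (a : OrthonormalBasis (Fin d) ℂ (EuclideanSpace ℂ (Fin d))) :
    Matrix (Fin d) (Fin d) ℂ :=
  Matrix.of fun x k => a k x

theorem conjTranspose_columnMatrix_mul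
    (a : OrthonormalBasis (Fin d) ℂ (EuclideanSpace ℂ (Fin d))) :
    (columnMatrix a)ᴴ * columnMatrix a = 1 := by
  ext i j
  have := a.inner_eq_ite i j
  rw [PiLp.inner_apply] at this
  simpa [columnMatrix, mul_apply, one_apply, mul_comm] using this

theorem columnMatrix_mul_conjTranspose
    (a : OrthonormalBasis (Fin d) ℂ (EuclideanSpace ℂ (Fin d))) :
    columnMatrix a * (columnMatrix a)ᴴ = 1 :=
  mul_eq_one_comm.1 (conjTranspose_columnMatrix_mul a)

/-- The vector `∑ i, s i |i⟩ ⊗ |i⟩`. -/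
noncomputable def diagonalVector (s : Fin d → ℝ) : EuclideanSpace ℂ (Fin d × Fin d) :=
  WithLp.toLp 2 fun x => if x.1 = x.2 then (s x.1 : ℂ) else 0

theorem schmidtVector_eq (a b : OrthonormalBasis (Fin d) ℂ (EuclideanSpace ℂ (Fin d)))
    (lam : Fin d → ℝ) :
    schmidtVector a b lam = WithLp.toLp 2 ((columnMatrix a ⊗ₖ columnMatrix b) *ᵥ
      (diagonalVector fun i => √(lam i)).ofLp) := by
  ext x
  simp [schmidtVector, columnMatrix, diagonalVector, mulVec, dotProduct, Fintype.sum_prod_type,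
    kroneckerMap_apply]
  exact Finset.sum_congr rfl fun i _ => by ring

/-- The variance in a Schmidt vector, for observables given by their matrices in the Schmidt
bases. -/
theorem variance_schmidtVector (a b : OrthonormalBasis (Fin d) ℂ (EuclideanSpace ℂ (Fin d)))
    (lam : Fin d → ℝ) (X Y : Matrix (Fin d) (Fin d) ℂ) :
    variance (pureState (schmidtVector a b lam))
      ((columnMatrix a * X * (columnMatrix a)ᴴ) ⊗ₖ (1 : Matrix (Fin d) (Fin d) ℂ) +
        (1 : Matrix (Fin d) (Fin d) ℂ) ⊗ₖ (columnMatrix b * Y * (columnMatrix b)ᴴ)) =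
    variance (pureState (diagonalVector fun i => √(lam i)))
      (X ⊗ₖ (1 : Matrix (Fin d) (Fin d) ℂ) + (1 : Matrix (Fin d) (Fin d) ℂ) ⊗ₖ Y) := by
  have hU : (columnMatrix a ⊗ₖ columnMatrix b)ᴴ * (columnMatrix a ⊗ₖ columnMatrix b) = 1 := by
    rw [conjTranspose_kronecker, ← mul_kronecker_mul, conjTranspose_columnMatrix_mul,
      conjTranspose_columnMatrix_mul, one_kronecker_one]
  rw [schmidtVector_eq, pureState_mulVec,
    ← variance_conj hU (pureState (diagonalVector fun i => √(lam i))), Matrix.mul_add, Matrix.add_mul,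
    conjTranspose_kronecker]
  simp only [← mul_kronecker_mul, Matrix.mul_one, columnMatrix_mul_conjTranspose]

theorem variance_pureState_conj (a : OrthonormalBasis (Fin d) ℂ (EuclideanSpace ℂ (Fin d)))
    (ψ : EuclideanSpace ℂ (Fin d)) (X : Matrix (Fin d) (Fin d) ℂ) :
    variance (pureState ψ) (columnMatrix a * X * (columnMatrix a)ᴴ) =
      variance (pureState (WithLp.toLp 2 ((columnMatrix a)ᴴ *ᵥ ψ.ofLp))) X := by
  rw [pureState_mulVec, ← variance_conj (conjTranspose_columnMatrix_mul a) (_ * _ * _) X]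
  congr 1
  calc pureState ψ = (columnMatrix a * (columnMatrix a)ᴴ) * pureState ψ *
        (columnMatrix a * (columnMatrix a)ᴴ) := by
        rw [columnMatrix_mul_conjTranspose, Matrix.one_mul, Matrix.mul_one]
    _ = _ := by simp only [Matrix.mul_assoc, conjTranspose_conjTranspose]

end Unitary

/-! ### Explicit variances -/

section Explicit

theorem variance_pureState {m : Type*} [Fintype m] (ψ : EuclideanSpace ℂ m)
    {H : Matrix m m ℂ} (hH : H.IsHermitian) :
    variance (pureState ψ) H =
      ∑ i, Complex.normSq ((H *ᵥ ψ.ofLp) i) - (star ψ.ofLp ⬝ᵥ H *ᵥ ψ.ofLp).re ^ 2 := by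
  have h (N : Matrix m m ℂ) :
      expectation (pureState ψ) N = (star ψ.ofLp ⬝ᵥ N *ᵥ ψ.ofLp).re := by
    have : pureState ψ = vecMulVec ψ.ofLp (star ψ.ofLp) := rfl
    rw [expectation, this, vecMulVec_mul, trace_vecMulVec, dotProduct_mulVec, dotProduct_comm]
  rw [variance, h, h, ← mulVec_mulVec, dotProduct_mulVec]
  congr 1
  have : star ψ.ofLp ᵥ* H = star (H *ᵥ ψ.ofLp) := by rw [star_mulVec, hH.eq]
  rw [this, dotProduct, Complex.re_sum]
  refine Finset.sum_congr rfl fun i _ => ?_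
  simp [Complex.normSq_apply]

variable {d : ℕ}

/-- `X e_k` is the `k`-th column, and the squared mean cancels its real diagonal entry. -/
theorem variance_pureState_single (k : Fin d) {X : Matrix (Fin d) (Fin d) ℂ}
    (hX : X.IsHermitian) :
    variance (pureState (WithLp.toLp 2 (Pi.single k 1))) X =
      ∑ i, if i = k then 0 else Complex.normSq (X i k) := by
  have him : (X k k).im = 0 := by
    have := hX.apply k k
    exact Complex.conj_eq_iff_im.1 this
  rw [variance_pureState _ hX]
  have h : (star (Pi.single k 1 : Fin d → ℂ) ⬝ᵥ X *ᵥ Pi.single k 1).re = (X k k).re := by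
    simp
  rw [h]
  simp only [mulVec_single_one, col_apply]
  rw [← Finset.add_sum_erase _ _ (Finset.mem_univ k),
    ← Finset.add_sum_erase Finset.univ (fun i => if i = k then 0 else Complex.normSq (X i k))
      (Finset.mem_univ k), if_pos rfl, Complex.normSq_apply, him]
  rw [Finset.sum_congr rfl fun i hi => (if_neg (Finset.ne_of_mem_erase hi))]
  ring

theorem isHermitian_single_add {i j : Fin d} :
    (Matrix.single i j (1 : ℂ) + Matrix.single j i 1).IsHermitian := by
  rw [IsHermitian, conjTranspose_add, conjTranspose_single, conjTranspose_single, star_one,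
    add_comm]

theorem isHermitian_single {i : Fin d} : (Matrix.single i i (1 : ℂ)).IsHermitian := by
  rw [IsHermitian, conjTranspose_single, star_one]

/-- For a unit vector this vanishes exactly when `|α i|` is `0` or `1`; it is the test that forces
vectors into the Schmidt basis. -/
theorem variance_pureState_matrixSingle (α : EuclideanSpace ℂ (Fin d)) (i : Fin d) :
    variance (pureState α) (Matrix.single i i 1) =
      Complex.normSq (α i) * (1 - Complex.normSq (α i)) := by
  rw [variance_pureState _ isHermitian_single]
  have h : (star α.ofLp ⬝ᵥ Matrix.single i i (1 : ℂ) *ᵥ α.ofLp).re = Complex.normSq (α i) := by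
    simp [dotProduct, single_mulVec, Function.update_apply, Complex.normSq_apply]
  rw [h]
  have h' (x : Fin d) : Complex.normSq ((Matrix.single i i (1 : ℂ) *ᵥ α.ofLp) x) =
      if x = i then Complex.normSq (α i) else 0 := by
    simp only [single_mulVec, Function.update_apply]
    split_ifs <;> simp
  simp only [h', Finset.sum_ite_eq', Finset.mem_univ, if_true]
  ring

/-- For a multiple of a basis vector the squared term drops out, so the variance reads off the mass
on `{i, j}`. -/
theorem variance_pureState_single_add (α : EuclideanSpace ℂ (Fin d)) {i j : Fin d}
    (hij : i ≠ j) :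
    variance (pureState α) (Matrix.single i j 1 + Matrix.single j i 1) =
      Complex.normSq (α i) + Complex.normSq (α j) - (2 * (star (α i) * α j).re) ^ 2 := by
  rw [variance_pureState _ isHermitian_single_add]
  have h' (x : Fin d) : ((Matrix.single i j (1 : ℂ) + Matrix.single j i 1) *ᵥ α.ofLp) x =
      (if x = i then α j else 0) + (if x = j then α i else 0) := by
    simp only [add_mulVec, single_mulVec, Function.update_apply, Pi.add_apply]
    split_ifs <;> simp
  have h : (star α.ofLp ⬝ᵥ (Matrix.single i j (1 : ℂ) + Matrix.single j i 1) *ᵥ α.ofLp).re =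
      2 * (star (α i) * α j).re := by
    rw [dotProduct]
    simp only [h', mul_add, Finset.sum_add_distrib]
    simp
    ring
  have h2 (x : Fin d) : Complex.normSq ((if x = i then α j else 0) + (if x = j then α i else 0)) =
      (if x = i then Complex.normSq (α j) else 0) +
        (if x = j then Complex.normSq (α i) else 0) := by
    by_cases h1 : x = i
    · have : x ≠ j := fun h => hij (h1.symm.trans h)
      simp [h1, hij]
    · simp only [h1, if_false, zero_add]
      split_ifs <;> simp
  simp only [h, h', h2, Finset.sum_add_distrib, Finset.sum_ite_eq', Finset.mem_univ, if_true]
  ring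

theorem isHermitian_local {X Y : Matrix (Fin d) (Fin d) ℂ} (hX : X.IsHermitian)
    (hY : Y.IsHermitian) :
    (X ⊗ₖ (1 : Matrix (Fin d) (Fin d) ℂ) +
      (1 : Matrix (Fin d) (Fin d) ℂ) ⊗ₖ Y).IsHermitian := by
  rw [IsHermitian, conjTranspose_add, conjTranspose_kronecker, conjTranspose_kronecker, hX.eq,
    hY.eq, conjTranspose_one]

/-- With `D = diag s`, the operator sends the coefficient matrix `D` to `X D + D Yᵀ`, whose entries
appear here. -/
theorem variance_diagonalVector (s : Fin d → ℝ) {X Y : Matrix (Fin d) (Fin d) ℂ}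
    (hX : X.IsHermitian) (hY : Y.IsHermitian) :
    variance (pureState (diagonalVector s))
      (X ⊗ₖ (1 : Matrix (Fin d) (Fin d) ℂ) + (1 : Matrix (Fin d) (Fin d) ℂ) ⊗ₖ Y) =
    ∑ i, ∑ j, Complex.normSq (s j * X i j + s i * Y j i) -
      (∑ i, s i ^ 2 * (X i i + Y i i).re) ^ 2 := by
  rw [variance_pureState _ (isHermitian_local hX hY)]
  have h (x : Fin d × Fin d) :
      ((X ⊗ₖ (1 : Matrix (Fin d) (Fin d) ℂ) + (1 : Matrix (Fin d) (Fin d) ℂ) ⊗ₖ Y) *ᵥ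
        (diagonalVector s).ofLp) x = s x.2 * X x.1 x.2 + s x.1 * Y x.2 x.1 := by
    simp [mulVec, dotProduct, Fintype.sum_prod_type, kroneckerMap_apply, diagonalVector, one_apply,
      mul_comm]
    simp [mul_add, Finset.sum_add_distrib, mul_comm]
  congr 1
  · simp only [h, Fintype.sum_prod_type]
  · congr 1
    rw [dotProduct, Complex.re_sum, Fintype.sum_prod_type]
    refine Finset.sum_congr rfl fun i _ => ?_
    rw [Finset.sum_eq_single i]
    · rw [h]
      simp [diagonalVector]
      ring
    · intro j _ hj
      simp [diagonalVector, hj.symm]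
    · simp

/-- The image has coefficient matrix the commutator `X D - D X` with `D = diag s`, and the mean is
zero. These observables yield the necessary conditions. -/
theorem variance_diagonalVector_neg_transpose (s : Fin d → ℝ) {X : Matrix (Fin d) (Fin d) ℂ}
    (hX : X.IsHermitian) :
    variance (pureState (diagonalVector s))
      (X ⊗ₖ (1 : Matrix (Fin d) (Fin d) ℂ) + (1 : Matrix (Fin d) (Fin d) ℂ) ⊗ₖ (-Xᵀ)) =
    ∑ i, ∑ j, (s i - s j) ^ 2 * Complex.normSq (X i j) := by
  rw [variance_diagonalVector s hX hX.transpose.neg]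
  have h (i j : Fin d) : Complex.normSq (s j * X i j + s i * (-Xᵀ) j i) =
      (s i - s j) ^ 2 * Complex.normSq (X i j) := by
    rw [neg_apply, transpose_apply, mul_neg, ← sub_eq_add_neg, ← sub_mul, Complex.normSq_mul,
      ← Complex.ofReal_sub, Complex.normSq_ofReal]
    ring
  simp only [h]
  simp

end Explicit

/-! ### Reduction to a linear program -/

section Characterization

variable {d : ℕ}

theorem exists_eq_columnMatrix_conj (a : OrthonormalBasis (Fin d) ℂ (EuclideanSpace ℂ (Fin d)))
    {X : Matrix (Fin d) (Fin d) ℂ} (hX : X.IsHermitian) :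
    ∃ X' : Matrix (Fin d) (Fin d) ℂ, X'.IsHermitian ∧
      columnMatrix a * X' * (columnMatrix a)ᴴ = X := by
  refine ⟨(columnMatrix a)ᴴ * X * columnMatrix a, isHermitian_conjTranspose_mul_mul _ hX, ?_⟩
  calc _ = (columnMatrix a * (columnMatrix a)ᴴ) * X * (columnMatrix a * (columnMatrix a)ᴴ) := by
        simp only [Matrix.mul_assoc]
    _ = X := by rw [columnMatrix_mul_conjTranspose, Matrix.one_mul, Matrix.mul_one]

theorem conjTranspose_columnMatrix_mulVec
    (a : OrthonormalBasis (Fin d) ℂ (EuclideanSpace ℂ (Fin d))) (k : Fin d) :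
    (columnMatrix a)ᴴ *ᵥ (a k).ofLp = Pi.single k 1 := by
  have : (a k).ofLp = columnMatrix a *ᵥ Pi.single k 1 := by
    ext x
    simp [columnMatrix]
  rw [this, mulVec_mulVec, conjTranspose_columnMatrix_mul, one_mulVec]

theorem sum_normSq_conjTranspose_columnMatrix_mulVec
    (a : OrthonormalBasis (Fin d) ℂ (EuclideanSpace ℂ (Fin d)))
    {ψ : EuclideanSpace ℂ (Fin d)} (hψ : ‖ψ‖ = 1) :
    ∑ i, Complex.normSq (((columnMatrix a)ᴴ *ᵥ ψ.ofLp) i) = 1 := by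
  have h (i : Fin d) : ((columnMatrix a)ᴴ *ᵥ ψ.ofLp) i = inner ℂ (a i) ψ := by
    simp [columnMatrix, mulVec, dotProduct, PiLp.inner_apply, mul_comm]
  simp only [h, Complex.normSq_eq_norm_sq, a.sum_sq_norm_inner_right, hψ, one_pow]

/-- The contributions of the entries `(i, j)` and `(j, i)` to the variance in a diagonal vector
dominate their contributions to the local variances. -/
theorem add_le_normSq_add_normSq {s r q q' t : ℝ} (h : t * (q + q') ≤ (s - r) ^ 2)
    (hs : 0 ≤ s) (hr : 0 ≤ r) (x y : ℂ) :
    t * ((q + q') * (Complex.normSq x + Complex.normSq y)) ≤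
      Complex.normSq (r * x + s * y) + Complex.normSq (s * star x + r * star y) := by
  have h1 := mul_le_mul_of_nonneg_right h
    (add_nonneg (Complex.normSq_nonneg x) (Complex.normSq_nonneg y))
  -- The right-hand side equals `(s - r) ^ 2 (|x| ^ 2 + |y| ^ 2) + 2 s r |x + y| ^ 2`.
  have h2 : 0 ≤ s * r * Complex.normSq (x + y) :=
    mul_nonneg (mul_nonneg hs hr) (Complex.normSq_nonneg _)
  simp only [Complex.normSq_apply, Complex.add_re, Complex.add_im, Complex.re_ofReal_mul,
    Complex.im_ofReal_mul, Complex.star_def, Complex.conj_re, Complex.conj_im] at *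
  linarith

/-- Weights satisfying the pairwise constraints make a parameter admissible, through the
local covariance matrices of the Schmidt bases. -/
theorem mem_admissibleParameters_of_weights
    {A B : Fin (d ^ 2) → Matrix (Fin d) (Fin d) ℂ}
    (hA : IsLocalOrthogonalObservables A) (hB : IsLocalOrthogonalObservables B)
    (a b : OrthonormalBasis (Fin d) ℂ (EuclideanSpace ℂ (Fin d))) {lam : Fin d → ℝ}
    (hlam : ∀ i, 0 ≤ lam i) (hlam1 : ∑ i, lam i = 1) {q : Fin d → ℝ} {t : ℝ}
    (hq : ∀ i, 0 ≤ q i) (hq1 : ∑ i, q i = 1) (ht1 : t ≤ 1)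
    (h : ∀ i j, i ≠ j → t * (q i + q j) ≤ (√(lam i) - √(lam j)) ^ 2) :
    t ∈ admissibleParameters A B (pureState (schmidtVector a b lam)) := by
  rw [mem_admissibleParameters_iff hA hB]
  refine ⟨ht1, d, q, a, b, hq, hq1, fun k => a.norm_eq_one k, fun k => b.norm_eq_one k, ?_⟩
  intro X' Y' hX' hY'
  obtain ⟨X, hX, rfl⟩ := exists_eq_columnMatrix_conj a hX'
  obtain ⟨Y, hY, rfl⟩ := exists_eq_columnMatrix_conj b hY'
  rw [variance_schmidtVector, variance_diagonalVector _ hX hY]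
  simp only [variance_pureState_conj, conjTranspose_columnMatrix_mulVec,
    variance_pureState_single _ hX, variance_pureState_single _ hY, Real.sq_sqrt (hlam _)]
  set s : Fin d → ℝ := fun i => √(lam i) with hs
  have hs0 (i : Fin d) : 0 ≤ s i := Real.sqrt_nonneg _
  have hs2 (i : Fin d) : s i * s i = lam i := Real.mul_self_sqrt (hlam i)
  -- Cauchy–Schwarz for the probability weights `lam`; it splits the squared mean into diagonal
  -- contributions.
  have hmean : (∑ i, lam i * (X i i + Y i i).re) ^ 2 ≤ ∑ i, lam i * (X i i + Y i i).re ^ 2 := by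
    have := Finset.sum_mul_sq_le_sq_mul_sq Finset.univ s fun i => s i * (X i i + Y i i).re
    simp only [← mul_assoc, hs2, mul_pow] at this
    simpa only [sq (s _), hs2, hlam1, one_mul] using this
  -- The gap, distributed over the entries. A single off-diagonal term may be negative; only the sum
  -- over `(i, j)` and `(j, i)` is controlled by the constraint.
  let F : Fin d → Fin d → ℝ := fun i j =>
    Complex.normSq (s j * X i j + s i * Y j i) -
      (if i = j then lam i * (X i i + Y i i).re ^ 2 else
        t * (q j * (Complex.normSq (X i j) + Complex.normSq (Y i j))))
  have hF (i j : Fin d) : 0 ≤ F i j + F j i := by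
    rcases eq_or_ne i j with rfl | hij
    · have : lam i * (X i i + Y i i).re ^ 2 ≤ Complex.normSq (s i * X i i + s i * Y i i) := by
        rw [← mul_add, Complex.normSq_mul, Complex.normSq_ofReal, hs2, Complex.normSq_apply]
        exact mul_le_mul_of_nonneg_left (by nlinarith [mul_self_nonneg (X i i + Y i i).im])
          (hlam i)
      simp only [F, if_true]
      linarith
    · have := add_le_normSq_add_normSq (h i j hij) (hs0 i) (hs0 j) (X i j) (Y j i)
      rw [hX.apply j i, hY.apply i j] at this
      have hn (Z : Matrix (Fin d) (Fin d) ℂ) (hZ : Z.IsHermitian) :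
          Complex.normSq (Z j i) = Complex.normSq (Z i j) := by
        rw [← hZ.apply i j]
        exact (Complex.normSq_conj _).symm
      simp only [F, if_neg hij, if_neg hij.symm]
      rw [hn X hX, hn Y hY] at *
      linarith
  have hsum : 0 ≤ ∑ i, ∑ j, F i j := by
    have h2 : ∑ i, ∑ j, (F i j + F j i) = 2 * ∑ i, ∑ j, F i j := by
      simp only [Finset.sum_add_distrib]
      rw [Finset.sum_comm (f := fun i j => F j i)]
      ring
    have : 0 ≤ ∑ i, ∑ j, (F i j + F j i) :=
      Finset.sum_nonneg fun i _ => Finset.sum_nonneg fun j _ => hF i j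
    linarith
  have hsplit : ∑ i, ∑ j, F i j = ∑ i, ∑ j, Complex.normSq (s j * X i j + s i * Y j i) -
      (∑ i, lam i * (X i i + Y i i).re ^ 2 +
        t * ∑ k, q k * ((∑ i, if i = k then 0 else Complex.normSq (X i k)) +
          ∑ i, if i = k then 0 else Complex.normSq (Y i k))) := by
    have h3 : ∑ k, q k * ((∑ i, if i = k then 0 else Complex.normSq (X i k)) +
          ∑ i, if i = k then 0 else Complex.normSq (Y i k)) =
        ∑ i, ∑ j, if i = j then 0 else
          q j * (Complex.normSq (X i j) + Complex.normSq (Y i j)) := by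
      rw [Finset.sum_comm]
      refine Finset.sum_congr rfl fun k _ => ?_
      rw [← Finset.sum_add_distrib, Finset.mul_sum]
      refine Finset.sum_congr rfl fun i _ => ?_
      split_ifs <;> simp
    have h4 : ∑ i, lam i * (X i i + Y i i).re ^ 2 =
        ∑ i, ∑ j, if i = j then lam i * (X i i + Y i i).re ^ 2 else 0 := by simp
    rw [h3, h4, Finset.mul_sum, ← Finset.sum_add_distrib, ← Finset.sum_sub_distrib]
    refine Finset.sum_congr rfl fun i _ => ?_
    rw [Finset.mul_sum, ← Finset.sum_add_distrib, ← Finset.sum_sub_distrib]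
    refine Finset.sum_congr rfl fun j _ => ?_
    simp only [F]
    split_ifs <;> simp
  linarith

/-- A positive admissible parameter forces the vectors `ψ_k, φ_k` into the Schmidt bases and
yields weights satisfying the pairwise constraints. -/
theorem exists_weights_of_mem_admissibleParameters
    {A B : Fin (d ^ 2) → Matrix (Fin d) (Fin d) ℂ}
    (hA : IsLocalOrthogonalObservables A) (hB : IsLocalOrthogonalObservables B)
    (a b : OrthonormalBasis (Fin d) ℂ (EuclideanSpace ℂ (Fin d))) {lam : Fin d → ℝ} {t : ℝ}
    (ht : 0 < t) (h : t ∈ admissibleParameters A B (pureState (schmidtVector a b lam))) :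
    ∃ w : Fin d → ℝ, (∀ i, 0 ≤ w i) ∧ ∑ i, w i = t ∧
      ∀ i j, i ≠ j → w i + w j ≤ (√(lam i) - √(lam j)) ^ 2 := by
  obtain ⟨-, K, p, ψ, φ, hp, hp1, hψ, hφ, h⟩ := (mem_admissibleParameters_iff hA hB _ _).1 h
  -- Test with `X` and `-Xᵀ` in the Schmidt bases; the sign does not affect the variance.
  have key (X : Matrix (Fin d) (Fin d) ℂ) (hX : X.IsHermitian) (hXr : Xᵀ = X) :
      t * ∑ k, p k * (variance (pureState (WithLp.toLp 2 ((columnMatrix a)ᴴ *ᵥ (ψ k).ofLp))) X +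
        variance (pureState (WithLp.toLp 2 ((columnMatrix b)ᴴ *ᵥ (φ k).ofLp))) X) ≤
      ∑ i, ∑ j, (√(lam i) - √(lam j)) ^ 2 * Complex.normSq (X i j) := by
    have := h _ _ (isHermitian_mul_mul_conjTranspose (columnMatrix a) hX)
      (isHermitian_mul_mul_conjTranspose (columnMatrix b) hX.transpose.neg)
    rw [variance_schmidtVector, variance_diagonalVector_neg_transpose _ hX] at this
    have hneg (ρ N : Matrix (Fin d) (Fin d) ℂ) : variance ρ (-N) = variance ρ N := by
      simp [variance, expectation]
    simpa only [variance_pureState_conj, hneg, hXr] using this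
  set α : Fin K → EuclideanSpace ℂ (Fin d) :=
    fun k => WithLp.toLp 2 ((columnMatrix a)ᴴ *ᵥ (ψ k).ofLp) with hα
  set β : Fin K → EuclideanSpace ℂ (Fin d) :=
    fun k => WithLp.toLp 2 ((columnMatrix b)ᴴ *ᵥ (φ k).ofLp) with hβ
  have hα1 (k : Fin K) : ∑ i, Complex.normSq (α k i) = 1 :=
    sum_normSq_conjTranspose_columnMatrix_mulVec a (hψ k)
  have hβ1 (k : Fin K) : ∑ i, Complex.normSq (β k i) = 1 :=
    sum_normSq_conjTranspose_columnMatrix_mulVec b (hφ k)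
  have hle {γ : EuclideanSpace ℂ (Fin d)} (hγ : ∑ i, Complex.normSq (γ i) = 1) (i : Fin d) :
      0 ≤ Complex.normSq (γ i) * (1 - Complex.normSq (γ i)) := by
    have := Finset.single_le_sum (f := fun i => Complex.normSq (γ i))
      (fun i _ => Complex.normSq_nonneg _) (Finset.mem_univ i)
    rw [hγ] at this
    exact mul_nonneg (Complex.normSq_nonneg _) (sub_nonneg.2 this)
  -- For `X = E_ii` the right side of `key` is zero, so, as `t > 0`, every nonnegative summand on
  -- the left vanishes.
  have hzero (i : Fin d) (k : Fin K) :
      p k * (Complex.normSq (α k i) * (1 - Complex.normSq (α k i)) +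
        Complex.normSq (β k i) * (1 - Complex.normSq (β k i))) = 0 := by
    have h0 := key _ (isHermitian_single (i := i)) (transpose_single _ _ _)
    have hr : ∑ x, ∑ y, (√(lam x) - √(lam y)) ^ 2 *
        Complex.normSq (Matrix.single i i (1 : ℂ) x y) = 0 := by
      refine Finset.sum_eq_zero fun x _ => Finset.sum_eq_zero fun y _ => ?_
      rw [single_apply]
      split_ifs with hxy
      · rw [← hxy.1, ← hxy.2]; simp
      · simp
    rw [hr] at h0
    simp only [variance_pureState_matrixSingle] at h0
    have hnn : ∀ k ∈ Finset.univ, 0 ≤ p k *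
        (Complex.normSq (α k i) * (1 - Complex.normSq (α k i)) +
          Complex.normSq (β k i) * (1 - Complex.normSq (β k i))) := fun k _ =>
      mul_nonneg (hp k) (add_nonneg (hle (hα1 k) i) (hle (hβ1 k) i))
    exact (Finset.sum_eq_zero_iff_of_nonneg hnn).1
      (le_antisymm (nonpos_of_mul_nonpos_right h0 ht) (Finset.sum_nonneg hnn)) k
      (Finset.mem_univ k)
  have hprod {γ : EuclideanSpace ℂ (Fin d)} (hγ : ∑ i, Complex.normSq (γ i) = 1) {i j : Fin d}
      (hij : i ≠ j) (hi : Complex.normSq (γ i) * (1 - Complex.normSq (γ i)) = 0) :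
      star (γ i) * γ j = 0 := by
    rcases mul_eq_zero.1 hi with hi | hi
    · simp [Complex.normSq_eq_zero.1 hi]
    · have h2 : ∑ x ∈ {i, j}, Complex.normSq (γ x) ≤ ∑ x, Complex.normSq (γ x) :=
        Finset.sum_le_sum_of_subset_of_nonneg (Finset.subset_univ _)
          fun x _ _ => Complex.normSq_nonneg _
      rw [Finset.sum_pair hij, hγ] at h2
      have : Complex.normSq (γ j) = 0 :=
        le_antisymm (by linarith) (Complex.normSq_nonneg _)
      simp [Complex.normSq_eq_zero.1 this]
  -- Each `α k` and `β k` has total mass `1`; the factor `1 / 2` averages the two sides, making the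
  -- weights sum to `t`.
  refine ⟨fun i => t / 2 * ∑ k, p k * (Complex.normSq (α k i) + Complex.normSq (β k i)),
    fun i => ?_, ?_, fun i j hij => ?_⟩
  · exact mul_nonneg (by linarith) (Finset.sum_nonneg fun k _ => mul_nonneg (hp k)
      (add_nonneg (Complex.normSq_nonneg _) (Complex.normSq_nonneg _)))
  · rw [← Finset.mul_sum, Finset.sum_comm]
    simp only [← Finset.mul_sum, Finset.sum_add_distrib, hα1, hβ1, ← Finset.sum_mul, hp1]
    ring
  · have h1 : t * ∑ k, p k * (variance (pureState (α k)) (Matrix.single i j 1 +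
        Matrix.single j i 1) + variance (pureState (β k)) (Matrix.single i j 1 +
        Matrix.single j i 1)) ≤ _ := key _ isHermitian_single_add
      (by rw [transpose_add, transpose_single, transpose_single, add_comm])
    have hr : ∑ x, ∑ y, (√(lam x) - √(lam y)) ^ 2 *
        Complex.normSq
          ((Matrix.single i j 1 + Matrix.single j i 1 : Matrix (Fin d) (Fin d) ℂ) x y) =
        2 * (√(lam i) - √(lam j)) ^ 2 := by
      have hx (x y : Fin d) : (√(lam x) - √(lam y)) ^ 2 *
          Complex.normSq
          ((Matrix.single i j 1 + Matrix.single j i 1 : Matrix (Fin d) (Fin d) ℂ) x y) =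
          (if x = i then if y = j then (√(lam x) - √(lam y)) ^ 2 else 0 else 0) +
          (if x = j then if y = i then (√(lam x) - √(lam y)) ^ 2 else 0 else 0) := by
        rw [Matrix.add_apply, single_apply, single_apply]
        by_cases hxi : x = i
        · have hxj : x ≠ j := fun h => hij (hxi.symm.trans h)
          rcases eq_or_ne y j with hyj | hyj
          · simp [hxi, hyj, hij]
          · simp [hxi, hyj, hyj.symm, hij, hij.symm]
        · by_cases hxj : x = j
          · rcases eq_or_ne y i with hyi | hyi
            · simp [hxj, hyi, hij.symm]
            · simp [hxj, hyi, hyi.symm, hij, hij.symm]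
          · simp [hxi, hxj, Ne.symm hxi, Ne.symm hxj]
      simp only [hx, Finset.sum_add_distrib]
      simp [Finset.sum_ite_irrel]
      ring
    have hk (k : Fin K) : p k * (variance (pureState (α k)) (Matrix.single i j 1 +
        Matrix.single j i 1) + variance (pureState (β k)) (Matrix.single i j 1 +
        Matrix.single j i 1)) =
        p k * (Complex.normSq (α k i) + Complex.normSq (β k i)) +
          p k * (Complex.normSq (α k j) + Complex.normSq (β k j)) := by
      rcases mul_eq_zero.1 (hzero i k) with h0 | h0
      · simp [h0]
      · have := hle (hα1 k) i
        have := hle (hβ1 k) i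
        rw [variance_pureState_single_add _ hij, variance_pureState_single_add _ hij,
          hprod (hα1 k) hij (by linarith), hprod (hβ1 k) hij (by linarith)]
        simp
        ring
    rw [hr] at h1
    simp only [hk, Finset.sum_add_distrib] at h1
    linarith

/-- If nonnegative weights with sum at most `1` satisfy the pairwise constraints and their sum
bounds that of all such weights, then it is the greatest admissible parameter. -/
theorem isGreatest_admissibleParameters
    {A B : Fin (d ^ 2) → Matrix (Fin d) (Fin d) ℂ}
    (hA : IsLocalOrthogonalObservables A) (hB : IsLocalOrthogonalObservables B)
    (a b : OrthonormalBasis (Fin d) ℂ (EuclideanSpace ℂ (Fin d))) {lam : Fin d → ℝ}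
    (hlam : ∀ i, 0 ≤ lam i) (hlam1 : ∑ i, lam i = 1) {w : Fin d → ℝ}
    (hw : ∀ i, 0 ≤ w i) (hw1 : ∑ i, w i ≤ 1)
    (hc : ∀ i j, i ≠ j → w i + w j ≤ (√(lam i) - √(lam j)) ^ 2)
    (hmax : ∀ v : Fin d → ℝ, (∀ i, 0 ≤ v i) →
      (∀ i j, i ≠ j → v i + v j ≤ (√(lam i) - √(lam j)) ^ 2) → ∑ i, v i ≤ ∑ i, w i) :
    IsGreatest (admissibleParameters A B (pureState (schmidtVector a b lam))) (∑ i, w i) := by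
  have hw0 : 0 ≤ ∑ i, w i := Finset.sum_nonneg fun i _ => hw i
  constructor
  · rcases hw0.eq_or_lt with h0 | h0
    · rw [← h0]
      -- At `t = 0` any probability vector serves; `lam` is at hand.
      exact mem_admissibleParameters_of_weights hA hB a b hlam hlam1 hlam hlam1 zero_le_one
        fun i j _ => by rw [zero_mul]; exact sq_nonneg _
    · refine mem_admissibleParameters_of_weights hA hB a b hlam hlam1
        (q := fun i => w i / ∑ i, w i) (fun i => div_nonneg (hw i) hw0) ?_ hw1 fun i j hij => ?_
      · rw [← Finset.sum_div, div_self h0.ne']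
      · rw [← add_div, mul_div_cancel₀ _ h0.ne']
        exact hc i j hij
  · intro t ht
    rcases le_or_gt t 0 with h0 | h0
    · exact h0.trans hw0
    · obtain ⟨v, hv, hvt, hvc⟩ := exists_weights_of_mem_admissibleParameters hA hB a b h0 ht
      exact hvt ▸ hmax v hv hvc

end Characterization

/-! ### Solving the linear program for `d = 3` and `d = 4` -/

section LowDimension

theorem isGreatest_admissibleParameters_three
    {A B : Fin (3 ^ 2) → Matrix (Fin 3) (Fin 3) ℂ}
    (hA : IsLocalOrthogonalObservables A) (hB : IsLocalOrthogonalObservables B)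
    (a b : OrthonormalBasis (Fin 3) ℂ (EuclideanSpace ℂ (Fin 3))) {lam : Fin 3 → ℝ}
    (hlam : ∀ i, 0 ≤ lam i) (hlam1 : ∑ i, lam i = 1) {i j k : Fin 3}
    (hij : i ≠ j) (hik : i ≠ k) (hjk : j ≠ k)
    (hmax : ∀ j' k' : Fin 3, (√(lam j') - √(lam k')) ^ 2 ≤ (√(lam j) - √(lam k)) ^ 2) :
    IsGreatest (admissibleParameters A B (pureState (schmidtVector a b lam)))
      (1 - (2 * √(lam i * lam j) + 2 * √(lam i * lam k) - lam i)) := by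
  have huniv : (Finset.univ : Finset (Fin 3)) = {i, j, k} := by
    clear hmax
    revert i j k
    decide
  have hsum (f : Fin 3 → ℝ) : ∑ x, f x = f i + f j + f k := by
    rw [huniv, Finset.sum_insert (by simp [hij, hik]), Finset.sum_pair hjk, add_assoc]
  have hall (x : Fin 3) : x = i ∨ x = j ∨ x = k := by
    have := Finset.mem_univ x
    rw [huniv] at this
    simpa using this
  set s : Fin 3 → ℝ := fun x => √(lam x) with hs
  have hs2 (x : Fin 3) : s x ^ 2 = lam x := Real.sq_sqrt (hlam x)
  -- The two sides differ by `2 (s i - s j) (s i - s k)`. If this were positive, `s i` would lie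
  -- outside the interval between `s j` and `s k`, against the maximality of their distance.
  have hbetween : (s i - s j) ^ 2 + (s i - s k) ^ 2 ≤ (s j - s k) ^ 2 := by
    have h1 := hmax i j
    have h2 := hmax i k
    change (s i - s j) ^ 2 ≤ (s j - s k) ^ 2 at h1
    change (s i - s k) ^ 2 ≤ (s j - s k) ^ 2 at h2
    by_contra! hcon
    have h3 : 0 < (s i - s j) * (s i - s k) := by nlinarith
    rcases pos_and_pos_or_neg_and_neg_of_mul_pos h3 with ⟨h4, h5⟩ | ⟨h4, h5⟩
    · rcases le_total (s j) (s k) with h6 | h6 <;> nlinarith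
    · rcases le_total (s j) (s k) with h6 | h6 <;> nlinarith
  have hval : 1 - (2 * √(lam i * lam j) + 2 * √(lam i * lam k) - lam i) =
      (s i - s j) ^ 2 + (s i - s k) ^ 2 := by
    have := hsum lam
    rw [Real.sqrt_mul (hlam i), Real.sqrt_mul (hlam i)]
    linear_combination this - hlam1 - 2 * hs2 i - hs2 j - hs2 k
  -- No weight on the middle index, both constraints through it tight; the remaining one is
  -- `hbetween`.
  let w : Fin 3 → ℝ := fun x => if x = i then 0 else (s i - s x) ^ 2
  have hwi : w i = 0 := if_pos rfl
  have hwj : w j = (s i - s j) ^ 2 := if_neg hij.symm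
  have hwk : w k = (s i - s k) ^ 2 := if_neg hik.symm
  have hwsum : ∑ x, w x = (s i - s j) ^ 2 + (s i - s k) ^ 2 := by
    rw [hsum, hwi, hwj, hwk, zero_add]
  have hw (x : Fin 3) : 0 ≤ w x := by
    simp only [w]
    split_ifs <;> positivity
  rw [hval, ← hwsum]
  refine isGreatest_admissibleParameters hA hB a b hlam hlam1 hw ?_ ?_ ?_
  · rw [hwsum, ← hval]
    -- The bound `∑ w ≤ 1` amounts to this; it follows from `s i ≤ s j + s k`.
    have h1 : lam i ≤ 2 * s i * (s j + s k) := by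
      have h0 : 0 ≤ s i := Real.sqrt_nonneg _
      have : s i ≤ s j + s k := by
        by_contra! hcon
        have h4 : 0 ≤ s j := Real.sqrt_nonneg _
        have h5 : 0 ≤ s k := Real.sqrt_nonneg _
        nlinarith
      rw [← hs2 i]
      nlinarith [Real.sqrt_nonneg (lam j), Real.sqrt_nonneg (lam k)]
    rw [Real.sqrt_mul (hlam i), Real.sqrt_mul (hlam i)]
    change 1 - (2 * (s i * s j) + 2 * (s i * s k) - lam i) ≤ 1
    linarith
  · intro x y hxy
    change w x + w y ≤ (s x - s y) ^ 2
    rcases hall x with rfl | rfl | rfl <;> rcases hall y with rfl | rfl | rfl <;>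
      first
        | exact absurd rfl hxy
        | (simp only [hwi, hwj, hwk]; linarith)
  · intro v hv hc
    have h1 := hc i j hij
    have h2 := hc i k hik
    rw [hwsum, hsum]
    linarith [hv i]

/-- Attainment of the maximum is claimed without given indices, so a valid triple has to be found.
If the maximal distance occurs at `j = k`, all values coincide and any triple works. -/
theorem exists_middle_index (s : Fin 3 → ℝ) :
    ∃ i j k : Fin 3, i ≠ j ∧ i ≠ k ∧ j ≠ k ∧
      ∀ j' k' : Fin 3, (s j' - s k') ^ 2 ≤ (s j - s k) ^ 2 := by
  obtain ⟨⟨j, k⟩, h⟩ := Finite.exists_max fun x : Fin 3 × Fin 3 => (s x.1 - s x.2) ^ 2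
  rcases eq_or_ne j k with rfl | hjk
  · refine ⟨0, 1, 2, by decide, by decide, by decide, fun j' k' => (h (j', k')).trans ?_⟩
    simpa using sq_nonneg (s 1 - s 2)
  · obtain ⟨i, hij, hik⟩ : ∃ i : Fin 3, i ≠ j ∧ i ≠ k := by
      clear h
      revert j k
      decide
    exact ⟨i, j, k, hij, hik, hjk, fun j' k' => h (j', k')⟩

theorem isGreatest_admissibleParameters_four
    {A B : Fin (4 ^ 2) → Matrix (Fin 4) (Fin 4) ℂ}
    (hA : IsLocalOrthogonalObservables A) (hB : IsLocalOrthogonalObservables B)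
    (a b : OrthonormalBasis (Fin 4) ℂ (EuclideanSpace ℂ (Fin 4))) {lam : Fin 4 → ℝ}
    (hlam : ∀ i, 0 ≤ lam i) (hlam1 : ∑ i, lam i = 1) :
    IsGreatest (admissibleParameters A B (pureState (schmidtVector a b lam)))
      (1 - max (max (2 * √(lam 0 * lam 1) + 2 * √(lam 2 * lam 3))
        (2 * √(lam 0 * lam 2) + 2 * √(lam 1 * lam 3)))
        (2 * √(lam 0 * lam 3) + 2 * √(lam 1 * lam 2))) := by
  set s : Fin 4 → ℝ := fun x => √(lam x) with hs
  have hs0 (x : Fin 4) : 0 ≤ s x := Real.sqrt_nonneg _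
  have hs2 (x : Fin 4) : s x ^ 2 = lam x := Real.sq_sqrt (hlam x)
  have hmul (x y : Fin 4) : √(lam x * lam y) = s x * s y := Real.sqrt_mul (hlam x) _
  simp only [hmul]
  set M := max (max (2 * (s 0 * s 1) + 2 * (s 2 * s 3)) (2 * (s 0 * s 2) + 2 * (s 1 * s 3)))
    (2 * (s 0 * s 3) + 2 * (s 1 * s 2)) with hM
  let σ : Equiv.Perm (Fin 4) := Tuple.sort s
  have hmono : Monotone (s ∘ σ) := Tuple.monotone_sort s
  have h01 : s (σ 0) ≤ s (σ 1) := hmono (by decide)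
  have h12 : s (σ 1) ≤ s (σ 2) := hmono (by decide)
  have h23 : s (σ 2) ≤ s (σ 3) := hmono (by decide)
  have hsum (f : Fin 4 → ℝ) : ∑ x, f x = f (σ 0) + f (σ 1) + f (σ 2) + f (σ 3) := by
    rw [← Equiv.sum_comp σ f, Fin.sum_univ_four]
  -- The neighbour matching in sorted order is, up to the order of pairs and within pairs, one of
  -- the three matchings in `M`.
  have hMle : 2 * (s (σ 0) * s (σ 1)) + 2 * (s (σ 2) * s (σ 3)) ≤ M := by
    have hdec : ∀ i j k l : Fin 4, i ≠ j → i ≠ k → i ≠ l → j ≠ k → j ≠ l → k ≠ l →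
        ∃ x ∈ ({(1, 2, 3), (2, 1, 3), (3, 1, 2)} : Finset (Fin 4 × Fin 4 × Fin 4)),
          (s(i, j) = s(0, x.1) ∧ s(k, l) = s(x.2.1, x.2.2)) ∨
            (s(k, l) = s(0, x.1) ∧ s(i, j) = s(x.2.1, x.2.2)) := by decide
    obtain ⟨⟨x, y, z⟩, hxyz, h⟩ := hdec (σ 0) (σ 1) (σ 2) (σ 3) (σ.injective.ne (by decide))
      (σ.injective.ne (by decide)) (σ.injective.ne (by decide)) (σ.injective.ne (by decide))
      (σ.injective.ne (by decide)) (σ.injective.ne (by decide))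
    have hprod {i j k l : Fin 4} (h : s(i, j) = s(k, l)) : s i * s j = s k * s l := by
      rcases Sym2.eq_iff.1 h with ⟨rfl, rfl⟩ | ⟨rfl, rfl⟩
      · rfl
      · exact mul_comm _ _
    have hxM : 2 * (s 0 * s x) + 2 * (s y * s z) ≤ M := by
      simp only [Finset.mem_insert, Finset.mem_singleton, Prod.mk.injEq] at hxyz
      rcases hxyz with ⟨rfl, rfl, rfl⟩ | ⟨rfl, rfl, rfl⟩ | ⟨rfl, rfl, rfl⟩
      · exact (le_max_left _ _).trans (le_max_left _ _)
      · exact (le_max_right _ _).trans (le_max_left _ _)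
      · exact le_max_right _ _
    rcases h with ⟨h1, h2⟩ | ⟨h1, h2⟩ <;> linarith [hprod h1, hprod h2]
  -- All weight sits on the smallest and the largest coefficient, making the constraints of both
  -- neighbouring pairs tight.
  let u : Fin 4 → ℝ := ![(s (σ 0) - s (σ 1)) ^ 2, 0, 0, (s (σ 2) - s (σ 3)) ^ 2]
  let w : Fin 4 → ℝ := fun x => u (σ.symm x)
  have hwsum : ∑ x, w x = (s (σ 0) - s (σ 1)) ^ 2 + (s (σ 2) - s (σ 3)) ^ 2 := by
    simp [hsum, w, u]
  have hval : ∑ x, w x = 1 - (2 * (s (σ 0) * s (σ 1)) + 2 * (s (σ 2) * s (σ 3))) := by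
    rw [hwsum, ← hlam1, hsum lam, ← hs2, ← hs2, ← hs2, ← hs2]
    ring
  have hw (x : Fin 4) : 0 ≤ w x := by
    have hu : ∀ y, 0 ≤ u y := by
      intro y
      fin_cases y <;> simp [u] <;> positivity
    exact hu _
  have hwc (i j : Fin 4) (hij : i ≠ j) : w i + w j ≤ (s i - s j) ^ 2 := by
    have hu : ∀ y z, y ≠ z → u y + u z ≤ (s (σ y) - s (σ z)) ^ 2 := by
      have hu' : ∀ y z, y < z → u y + u z ≤ (s (σ y) - s (σ z)) ^ 2 := by
        intro y z hyz
        fin_cases y <;> fin_cases z <;>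
          first
            | exact absurd hyz (by decide)
            | (simp [u]; done)
            | (simp [u]; nlinarith)
      intro y z hyz
      rcases lt_or_gt_of_ne hyz with h | h
      · exact hu' y z h
      · have := hu' z y h
        rw [← neg_sq, neg_sub]
        linarith
    have := hu (σ.symm i) (σ.symm j) (σ.symm.injective.ne hij)
    simpa only [Equiv.apply_symm_apply] using this
  -- Each perfect matching bounds `∑ v` by the sum of its two constraints, whose squares expand to
  -- `1` minus the cross terms.
  have hbound (v : Fin 4 → ℝ) (hvc : ∀ i j, i ≠ j → v i + v j ≤ (s i - s j) ^ 2) :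
      M ≤ 1 - ∑ x, v x := by
    have h1 := hvc 0 1 (by decide)
    have h2 := hvc 2 3 (by decide)
    have h3 := hvc 0 2 (by decide)
    have h4 := hvc 1 3 (by decide)
    have h5 := hvc 0 3 (by decide)
    have h6 := hvc 1 2 (by decide)
    rw [Fin.sum_univ_four] at hlam1 ⊢
    simp only [← hs2] at hlam1
    refine max_le (max_le ?_ ?_) ?_ <;> linarith
  -- `hbound` for `w` gives `M ≤ 1 - ∑ w`; the reverse is `hMle` with `hval`.
  have hMval : 1 - M = ∑ x, w x := by
    have := hbound w hwc
    linarith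
  rw [hMval]
  refine isGreatest_admissibleParameters hA hB a b hlam hlam1 hw ?_ hwc fun v _ hvc => ?_
  · rw [hval]
    have := mul_nonneg (hs0 (σ 0)) (hs0 (σ 1))
    have := mul_nonneg (hs0 (σ 2)) (hs0 (σ 3))
    linarith
  · have := hbound v hvc
    linarith

end LowDimension

end CMCEntanglement

/-! ### The proposition -/

theorem mainTheorem4 :
    (∀ (A B : Fin (3 ^ 2) → Matrix (Fin 3) (Fin 3) ℂ),
      CMCEntanglement.IsLocalOrthogonalObservables A →
      CMCEntanglement.IsLocalOrthogonalObservables B →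
      ∀ (a b : OrthonormalBasis (Fin 3) ℂ (EuclideanSpace ℂ (Fin 3))) (lam : Fin 3 → ℝ),
      (∀ i, 0 ≤ lam i) → ∑ i, lam i = 1 →
      ∀ ρ : Matrix (Fin 3 × Fin 3) (Fin 3 × Fin 3) ℂ,
      ρ = CMCEntanglement.pureState (CMCEntanglement.schmidtVector a b lam) →
      IsGreatest (CMCEntanglement.admissibleParameters A B ρ) (CMCEntanglement.V A B ρ) ∧
      ∀ i₀ j₀ k₀ : Fin 3, i₀ ≠ j₀ → i₀ ≠ k₀ → j₀ ≠ k₀ →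
        (∀ j k : Fin 3, (√(lam j) - √(lam k)) ^ 2 ≤ (√(lam j₀) - √(lam k₀)) ^ 2) →
        CMCEntanglement.entanglementParameter A B ρ =
          2 * √(lam i₀ * lam j₀) + 2 * √(lam i₀ * lam k₀) - lam i₀) ∧
    (∀ (A B : Fin (4 ^ 2) → Matrix (Fin 4) (Fin 4) ℂ),
      CMCEntanglement.IsLocalOrthogonalObservables A →
      CMCEntanglement.IsLocalOrthogonalObservables B →
      ∀ (a b : OrthonormalBasis (Fin 4) ℂ (EuclideanSpace ℂ (Fin 4))) (lam : Fin 4 → ℝ),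
      (∀ i, 0 ≤ lam i) → ∑ i, lam i = 1 →
      ∀ ρ : Matrix (Fin 4 × Fin 4) (Fin 4 × Fin 4) ℂ,
      ρ = CMCEntanglement.pureState (CMCEntanglement.schmidtVector a b lam) →
      IsGreatest (CMCEntanglement.admissibleParameters A B ρ) (CMCEntanglement.V A B ρ) ∧
      CMCEntanglement.entanglementParameter A B ρ =
        max (max (2 * √(lam 0 * lam 1) + 2 * √(lam 2 * lam 3))
          (2 * √(lam 0 * lam 2) + 2 * √(lam 1 * lam 3)))
          (2 * √(lam 0 * lam 3) + 2 * √(lam 1 * lam 2))) := by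
  constructor
  · rintro A B hA hB a b lam hlam hlam1 ρ rfl
    refine ⟨?_, fun i j k hij hik hjk hmax => ?_⟩
    · obtain ⟨i, j, k, hij, hik, hjk, hmax⟩ :=
        CMCEntanglement.exists_middle_index fun x => √(lam x)
      have h := CMCEntanglement.isGreatest_admissibleParameters_three hA hB a b hlam hlam1
        hij hik hjk hmax
      rwa [CMCEntanglement.V, h.csSup_eq]
    · have h := CMCEntanglement.isGreatest_admissibleParameters_three hA hB a b hlam hlam1
        hij hik hjk hmax
      rw [CMCEntanglement.entanglementParameter, CMCEntanglement.V, h.csSup_eq, sub_sub_cancel]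
  · rintro A B hA hB a b lam hlam hlam1 ρ rfl
    have h := CMCEntanglement.isGreatest_admissibleParameters_four hA hB a b hlam hlam1
    refine ⟨?_, ?_⟩
    · rwa [CMCEntanglement.V, h.csSup_eq]
    · rw [CMCEntanglement.entanglementParameter, CMCEntanglement.V, h.csSup_eq, sub_sub_cancel]
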